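/- Let $P$ be a finite set of proposition letters and $I$ a finite index set. A labeled transition system (LTS) $M_a$ consists of a set of states $\mathrm{dom}(M)$, a distinguished state $a$, a subset $p^M\subseteq \mathrm{dom}(M)$ for each $p\in P$ and a binary relation $R_i^M$ on $\mathrm{dom}(M)$ for each $i\in I$; it is image-finite if every state $m$ has only finitely many successors, i.e. states $n$ with $R_i^M(m,n)$ for some $i\in I$. Homomorphisms preserve the distinguished state and all the relations $p$ and $R_i$. A directed path of length $r$ from $s_0$ to $s_r$ is a sequence of facts $R_{i_1}(s_0,s_1),\dots,R_{i_r}(s_{r-1},s_r)$ (with $r\ge 0$). The depth of a state is the length of a shortest directed path from the distinguished state to it. A tree is an LTS in which each state is reached from the distinguished state by exactly one directed path; its depth is the supremum of the depths of its states. The unraveling $\mathtt{unr}(M_a)$ is the tree whose states are the directed paths $\pi$ of $M$ that start at $a$, with the empty path as distinguished state, where $\pi$ satisfies $p$ iff its last state lies in $p^M$, and where $R_i(\pi,\pi')$ holds iff $\pi'$ is $\pi$ extended by one fact $R_i(\mathrm{last}(\pi),u)$ of $M$; $\mathtt{unr}^k(M_a)$ is its substructure of states of depth at most $k$. Graded modal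 logic has the formulas $\varphi ::= \top \mid p \mid \neg\varphi \mid \varphi\wedge\varphi\mid\varphi\vee\varphi\mid\Diamond_i\varphi\mid\Box_i\varphi\mid\Diamond_i^{\ge n}\varphi$ ($p \in P$, $i\in I$, $n\geq 1$), where $\Diamond_i^{\ge n}\varphi$ says that at least $n$ distinct $R_i$-successors satisfy $\varphi$; the modal depth is the maximal nesting depth of modalities. Let $M_a$ and $N_b$ be image-finite LTSs and $k\in\mathbb N$. Then there are only finitely many homomorphisms from each finite tree of depth at most $k$ to $M_a$ and to $N_b$, and the following are equivalent: 1. for every finite tree $T_c$ of depth at most $k$, the number of homomorphisms from $T_c$ to $M_a$ equals the number of homomorphisms from $T_c$ to $N_b$; 2. $\mathtt{unr}^k(M_a)\cong\mathtt{unr}^k(N_b)$; 3. $M_a$ and $N_b$ satisfy the same formulas of graded modal logic of modal depth at most $k$. Moreover, if in each of $M$ and $N$ distinct actions are disjoint ($R_i\cap R_j=\emptyset$ for $i\ne j$), the same equivalence holds when in 2. the unraveling is replaced by the one that records only the visited states: its states are the strings $w=\langle w_1,\dots,w_n\rangle$ of states with $w_1=a$ in which each $w_{j+1}$ is a successor of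 $w_j$, its distinguished state is $\langle a\rangle$, $w$ satisfies $p$ iff $w_n\in p^M$, and $R_i(w,w')$ holds iff $w'$ is $w$ extended by one state $u$ with $R_i^M(w_n,u)$. -/

import Mathlib

universe u v w x y

/-- A labeled transition system over the modal signature with proposition letters `P` and
actions `R_i`, `i : I`: a structure with a set of states, one unary relation for each letter, one
binary relation for each action, and one distinguished state. -/
structure LTS (P : Type u) (I : Type v) where
  State : Type w
  root : State
  prop : P → State → Prop
  act : I → State → State → Prop

namespace LTS

variable {P : Type u} {I : Type v}

/-- The set of successors of a state along arbitrary actions. -/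
def succ (M : LTS.{u, v, w} P I) (m : M.State) : Set M.State :=
  {n | ∃ i, M.act i m n}

def ImageFinite (M : LTS.{u, v, w} P I) : Prop :=
  ∀ m, (M.succ m).Finite

/-- Distinct actions never share a transition. -/
def DisjointActions (M : LTS.{u, v, w} P I) : Prop :=
  ∀ i j m n, M.act i m n → M.act j m n → i = j

/-- Homomorphisms of pointed structures. -/
structure Hom (M : LTS.{u, v, w} P I) (N : LTS.{u, v, x} P I) where
  toFun : M.State → N.State
  map_root : toFun M.root = N.root
  map_prop : ∀ p m, M.prop p m → N.prop p (toFun m)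
  map_act : ∀ i m n, M.act i m n → N.act i (toFun m) (toFun n)

/-- The homomorphism count over the semiring of natural numbers. -/
noncomputable def homCount (M : LTS.{u, v, w} P I) (N : LTS.{u, v, x} P I) : ℕ :=
  Nat.card (Hom M N)

/-- Existence of an isomorphism of pointed structures: a bijection that preserves the distinguished
state and preserves and reflects all relations. -/
def Isomorphic (M : LTS.{u, v, w} P I) (N : LTS.{u, v, x} P I) : Prop :=
  ∃ e : M.State ≃ N.State, e M.root = N.root ∧
    (∀ p m, M.prop p m ↔ N.prop p (e m)) ∧
    (∀ i m n, M.act i m n ↔ N.act i (e m) (e n))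

/-- `M.IsPath m l n`: the facts `R_{i₁}(m, s₁), R_{i₂}(s₁, s₂), …` with
`l = [(i₁, s₁), (i₂, s₂), …]` form a directed path from `m` to `n`. Its length is `l.length`. -/
def IsPath (M : LTS.{u, v, w} P I) : M.State → List (I × M.State) → M.State → Prop
  | m, [], n => m = n
  | m, (i, s) :: l, n => M.act i m s ∧ M.IsPath s l n

/-- There is exactly one directed path from the root to each state. -/
def IsTree (M : LTS.{u, v, w} P I) : Prop :=
  ∀ m, ∃! l, M.IsPath M.root l m

/-- The length of a shortest directed path from the root (`⊤` if there is none). -/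
noncomputable def depthOf (M : LTS.{u, v, w} P I) (m : M.State) : ℕ∞ :=
  ⨅ (l : List (I × M.State)) (_ : M.IsPath M.root l m), (l.length : ℕ∞)

/-- The depth of a (point-generated) LTS: the supremum of the depths of its states. -/
noncomputable def depth (M : LTS.{u, v, w} P I) : ℕ∞ :=
  ⨆ m, M.depthOf m

/-- The class of finite trees of depth at most `k`. -/
def finiteTrees (P : Type u) (I : Type v) (k : ℕ) : Set (LTS.{u, v, w} P I) :=
  {T | Finite T.State ∧ T.IsTree ∧ T.depth ≤ k}

theorem depthOf_root (M : LTS.{u, v, w} P I) : M.depthOf M.root = 0 :=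
  le_antisymm
    (iInf₂_le (f := fun (l : List (I × M.State)) (_ : M.IsPath M.root l M.root) => (l.length : ℕ∞))
      [] rfl) bot_le

/-- The substructure of all states of depth at most `k`. -/
def truncate (M : LTS.{u, v, w} P I) (k : ℕ) : LTS.{u, v, w} P I where
  State := {m : M.State // M.depthOf m ≤ k}
  root := ⟨M.root, by rw [M.depthOf_root]; exact bot_le⟩
  prop p m := M.prop p m
  act i m n := M.act i m n

/-- The tree unraveling. Its states are the directed paths that start at the root, given as the
list of the actions taken and states visited, together with the last state. -/
def unravel (M : LTS.{u, v, w} P I) : LTS.{u, v, max v w} P I where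
  State := {q : List (I × M.State) × M.State // M.IsPath M.root q.1 q.2}
  root := ⟨([], M.root), rfl⟩
  prop p q := M.prop p q.1.2
  act i q r := M.act i q.1.2 r.1.2 ∧ r.1.1 = q.1.1 ++ [(i, r.1.2)]

/-- The unraveling whose states record only the states visited, not the actions taken: the nonempty
strings of states that start with the root and in which each state is a successor of the previous
one. -/
def stateUnravel (M : LTS.{u, v, w} P I) : LTS.{u, v, w} P I where
  State := {q : List M.State // q.head? = some M.root ∧ q.IsChain (fun m n => ∃ i, M.act i m n)}
  root := ⟨[M.root], rfl, List.IsChain.singleton _⟩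
  prop p q := ∃ m, q.1.getLast? = some m ∧ M.prop p m
  act i q r := ∃ m n, q.1.getLast? = some m ∧ M.act i m n ∧ r.1 = q.1 ++ [n]

end LTS

/-- Formulas of graded modal logic; `gdia n i φ` says that at least `n` many `R_i`-successors
satisfy `φ`. -/
inductive GML (P : Type u) (I : Type v) : Type (max u v)
  | top : GML P I
  | letter : P → GML P I
  | neg : GML P I → GML P I
  | and : GML P I → GML P I → GML P I
  | or : GML P I → GML P I → GML P I
  | dia : I → GML P I → GML P I
  | box : I → GML P I → GML P I
  | gdia : ℕ+ → I → GML P I → GML P I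

namespace GML

variable {P : Type u} {I : Type v}

def modalDepth : GML P I → ℕ
  | top => 0
  | letter _ => 0
  | neg φ => φ.modalDepth
  | and φ ψ => max φ.modalDepth ψ.modalDepth
  | or φ ψ => max φ.modalDepth ψ.modalDepth
  | dia _ φ => φ.modalDepth + 1
  | box _ φ => φ.modalDepth + 1
  | gdia _ _ φ => φ.modalDepth + 1

def Sat (M : LTS.{u, v, w} P I) : M.State → GML P I → Prop
  | _, top => True
  | m, letter p => M.prop p m
  | m, neg φ => ¬ Sat M m φ
  | m, and φ ψ => Sat M m φ ∧ Sat M m ψ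
  | m, or φ ψ => Sat M m φ ∨ Sat M m ψ
  | m, dia i φ => ∃ n, M.act i m n ∧ Sat M n φ
  | m, box i φ => ∀ n, M.act i m n → Sat M n φ
  | m, gdia c i φ => ((c : ℕ) : ℕ∞) ≤ Set.encard {n | M.act i m n ∧ Sat M n φ}

/-- Satisfaction of the same formulas of modal depth at most `k` at the distinguished states. -/
def EquivUpTo (k : ℕ) (M : LTS.{u, v, w} P I) (N : LTS.{u, v, x} P I) : Prop :=
  ∀ φ : GML P I, φ.modalDepth ≤ k → (Sat M M.root φ ↔ Sat N N.root φ)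

end GML

/-!
All three conditions say that the distinguished states are graded bisimilar to depth `k`: they
satisfy the same letters and, if `k > 0`, their successors along each action can be matched one to
one with successors that are graded bisimilar to depth `k - 1`.

Such matchings are isomorphisms of unravelings, since the unraveling to depth `k + 1` consists of a
new root placed above the unravelings of the successors to depth `k`. Homomorphisms from a tree of
depth at most `k` lift uniquely to the unraveling to depth `k`, so they are counted by its
isomorphism type. Conversely, gluing trees at their roots multiplies the numbers of homomorphisms.
The count at a fixed state is thus a character of a free monoid of trees, and adding a transition
on top of a tree sums the counts over the successors of the state. As distinct characters are
linearly independent (Dedekind), these sums determine the characters of the successors with their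
multiplicities, which matches the successors. In the logic, local finiteness allows one formula to
isolate the theory of one successor from those of finitely many others, and `gdia` counts the
successors with that theory.
-/

universe z z'

theorem exists_equiv_of_card_fiber_eq {α β γ : Type*} [Finite α] [Finite β] {f : α → γ}
    {g : β → γ} (h : ∀ c, Nat.card {a // f a = c} = Nat.card {b // g b = c}) :
    ∃ e : α ≃ β, ∀ a, g (e a) = f a :=
  ⟨Equiv.ofFiberEquiv fun c => (Finite.card_eq.1 (h c)).some, Equiv.ofFiberEquiv_map _⟩

theorem exists_equiv_of_finsum_monoidHom_eq {α β G L : Type*} [Finite α] [Finite β]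
    [MulOneClass G] [CommRing L] [IsDomain L] [CharZero L] {χ : α → G →* L} {ψ : β → G →* L}
    (h : ∀ x, ∑ᶠ a, χ a x = ∑ᶠ b, ψ b x) : ∃ e : α ≃ β, ∀ a, ψ (e a) = χ a := by
  classical
  have := Fintype.ofFinite α
  have := Fintype.ofFinite β
  have coeff_eq : ∑ a, Finsupp.single (χ a) (1 : L) = ∑ b, Finsupp.single (ψ b) 1 := by
    refine linearIndependent_monoidHom G L (funext fun x => ?_)
    simpa [finsum_eq_sum_of_fintype] using h x
  refine exists_equiv_of_card_fiber_eq fun c => ?_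
  simpa [Finsupp.finsetSum_apply, Finsupp.single_apply, Fintype.card_subtype]
    using DFunLike.congr_fun coeff_eq c

open Classical in
theorem freeMonoid_lift_ite_one_zero {α R : Type*} [MonoidWithZero R] (q : α → Prop)
    (s : FreeMonoid α) :
    FreeMonoid.lift (fun a => if q a then (1 : R) else 0) s = if ∀ a ∈ s, q a then 1 else 0 := by
  induction s using FreeMonoid.inductionOn' with
  | one => simp [FreeMonoid.notMem_one]
  | of_mul a s ih =>
    simp only [map_mul, FreeMonoid.lift_eval_of, ih, ite_zero_mul_ite_zero, mul_one]
    simp [FreeMonoid.mem_mul, FreeMonoid.mem_of]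

namespace LTS

variable {P : Type u} {I : Type v}

/-- Image-finiteness action by action, which is weaker than `ImageFinite` when there are infinitely
many actions. -/
def LocallyFinite (M : LTS.{u, v, w} P I) : Prop :=
  ∀ i m, Finite {n // M.act i m n}

theorem ImageFinite.locallyFinite {M : LTS.{u, v, w} P I} (hM : M.ImageFinite) :
    M.LocallyFinite :=
  fun i m => (hM m).subset fun _ hn => ⟨i, hn⟩

/-- The same transition system with another distinguished state. -/
def withRoot (M : LTS.{u, v, w} P I) (m : M.State) : LTS.{u, v, w} P I :=
  { M with root := m }

/-! ### Directed paths -/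

theorem isPath_withRoot (M : LTS.{u, v, w} P I) {r m n : M.State} {l : List (I × M.State)} :
    (M.withRoot r).IsPath m l n ↔ M.IsPath m l n := by
  induction l generalizing m with
  | nil => rfl
  | cons a l ih => exact and_congr_right' ih

theorem isPath_append (M : LTS.{u, v, w} P I) {l l' : List (I × M.State)} {m n : M.State} :
    M.IsPath m (l ++ l') n ↔ ∃ s, M.IsPath m l s ∧ M.IsPath s l' n := by
  induction l generalizing m with
  | nil => simp [IsPath]
  | cons a l ih => simp only [List.cons_append, IsPath, ih, ← exists_and_left, and_assoc]

theorem isPath_concat (M : LTS.{u, v, w} P I) {l : List (I × M.State)} {i : I}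
    {m n t : M.State} :
    M.IsPath m (l ++ [(i, t)]) n ↔ ∃ s, M.IsPath m l s ∧ M.act i s t ∧ t = n := by
  simp only [isPath_append, IsPath]

theorem IsPath.unique {M : LTS.{u, v, w} P I} {l : List (I × M.State)} {m n n' : M.State}
    (h₁ : M.IsPath m l n) (h₂ : M.IsPath m l n') : n = n' := by
  induction l generalizing m with
  | nil => exact Eq.trans (Eq.symm h₁) h₂
  | cons a l ih => exact ih h₁.2 h₂.2

/-- The list of facts obtained by applying a map to the states in a list of facts. -/
def mapPath {S : Type w} {S' : Type x} (f : S → S') (l : List (I × S)) : List (I × S') :=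
  l.map (Prod.map id f)

theorem length_mapPath {S : Type w} {S' : Type x} (f : S → S') (l : List (I × S)) :
    (mapPath f l).length = l.length :=
  List.length_map _

theorem mapPath_concat {S : Type w} {S' : Type x} (f : S → S') (l : List (I × S)) (i : I) (s : S) :
    mapPath f (l ++ [(i, s)]) = mapPath f l ++ [(i, f s)] :=
  List.map_append

theorem IsPath.map {M : LTS.{u, v, w} P I} {N : LTS.{u, v, x} P I} {f : M.State → N.State}
    (hf : ∀ i m n, M.act i m n → N.act i (f m) (f n)) {l : List (I × M.State)} {m n : M.State}
    (h : M.IsPath m l n) : N.IsPath (f m) (mapPath f l) (f n) := by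
  induction l generalizing m with
  | nil => exact congrArg f h
  | cons a l ih => exact ⟨hf _ _ _ h.1, ih h.2⟩

theorem depthOf_le_of_isPath {M : LTS.{u, v, w} P I} {l : List (I × M.State)} {m : M.State}
    (h : M.IsPath M.root l m) : M.depthOf m ≤ l.length :=
  iInf₂_le (f := fun (l : List (I × M.State)) (_ : M.IsPath M.root l m) => (l.length : ℕ∞)) l h

theorem LocallyFinite.finite_setOf_isPath {M : LTS.{u, v, w} P I} (hM : M.LocallyFinite)
    (labels : List I) (m : M.State) :
    {n | ∃ l, l.map Prod.fst = labels ∧ M.IsPath m l n}.Finite := by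
  induction labels generalizing m with
  | nil =>
    refine (Set.finite_singleton m).subset ?_
    rintro n ⟨l, hl, h⟩
    obtain rfl := List.map_eq_nil_iff.1 hl
    exact Eq.symm h
  | cons i labels ih =>
    have finite_act : {s | M.act i m s}.Finite := hM i m
    refine (finite_act.biUnion fun s _ => ih s).subset ?_
    rintro n ⟨_ | ⟨⟨j, s⟩, l⟩, hl, h⟩
    · cases hl
    · obtain ⟨rfl, rfl⟩ := List.cons.inj hl
      exact Set.mem_biUnion h.1 ⟨l, rfl, h.2⟩

/-! ### Homomorphisms and isomorphisms -/

namespace Hom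

variable {L : LTS.{u, v, y} P I} {M : LTS.{u, v, w} P I} {N : LTS.{u, v, x} P I}

@[ext]
theorem ext {f g : Hom M N} (h : ∀ m, f.toFun m = g.toFun m) : f = g := by
  cases f; cases g
  congr
  exact funext h

/-- Composition of homomorphisms. -/
def comp (g : Hom M N) (f : Hom L M) : Hom L N where
  toFun m := g.toFun (f.toFun m)
  map_root := by rw [f.map_root, g.map_root]
  map_prop p m h := g.map_prop _ _ (f.map_prop _ _ h)
  map_act i m n h := g.map_act _ _ _ (f.map_act _ _ _ h)

theorem isPath (f : Hom M N) {l : List (I × M.State)} {m : M.State} (h : M.IsPath M.root l m) :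
    N.IsPath N.root (mapPath f.toFun l) (f.toFun m) :=
  f.map_root ▸ h.map f.map_act

theorem depthOf_le (f : Hom M N) (m : M.State) : N.depthOf (f.toFun m) ≤ M.depthOf m :=
  le_iInf₂ fun l h => (depthOf_le_of_isPath (f.isPath h)).trans_eq (by rw [length_mapPath])

/-- The restriction of a homomorphism to the states of depth at most `k`. -/
def truncate (f : Hom M N) (k : ℕ) : Hom (M.truncate k) (N.truncate k) where
  toFun m := ⟨f.toFun m.1, (f.depthOf_le m.1).trans m.2⟩
  map_root := Subtype.ext f.map_root
  map_prop p m := f.map_prop p m.1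
  map_act i m n := f.map_act i m.1 n.1

theorem toFun_root {n : N.State} (f : Hom M (N.withRoot n)) : f.toFun M.root = n :=
  f.map_root

theorem prop_of_prop_root {n : N.State} (f : Hom M (N.withRoot n)) {p : P}
    (h : M.prop p M.root) : N.prop p n := by
  have := f.map_prop p _ h
  rwa [f.toFun_root] at this

theorem act_of_act_root {n : N.State} (f : Hom M (N.withRoot n)) {i : I} {m : M.State}
    (h : M.act i M.root m) : N.act i n (f.toFun m) := by
  have := f.map_act i _ _ h
  rwa [f.toFun_root] at this

theorem sigma_ext {S : N.State → Prop} {f g : Σ s : {s // S s}, Hom M (N.withRoot s.1)}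
    (h : f.2.toFun = g.2.toFun) : f = g := by
  obtain ⟨⟨s, hs⟩, f⟩ := f
  obtain ⟨⟨t, ht⟩, g⟩ := g
  obtain rfl : s = t := f.toFun_root.symm.trans ((congrFun h _).trans g.toFun_root)
  rw [show f = g from Hom.ext (congrFun h)]

end Hom

theorem isomorphic_iff_exists_inverse {M : LTS.{u, v, w} P I} {N : LTS.{u, v, x} P I} :
    Isomorphic M N ↔ ∃ (f : Hom M N) (g : Hom N M),
      Function.LeftInverse g.toFun f.toFun ∧ Function.RightInverse g.toFun f.toFun := by
  constructor
  · rintro ⟨e, hr, hp, ha⟩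
    exact ⟨⟨e, hr, fun p m => (hp p m).1, fun i m n => (ha i m n).1⟩,
      ⟨e.symm, by rw [← hr, e.symm_apply_apply], fun p m => by simp [hp],
        fun i m n => by simp [ha]⟩, e.left_inv, e.right_inv⟩
  · rintro ⟨f, g, gf, fg⟩
    refine ⟨⟨f.toFun, g.toFun, gf, fg⟩, f.map_root, fun p m => ⟨f.map_prop p m, fun h => ?_⟩,
      fun i m n => ⟨f.map_act i m n, fun h => ?_⟩⟩
    · simpa only [Equiv.coe_fn_mk, gf m] using g.map_prop p _ h
    · simpa only [Equiv.coe_fn_mk, gf m, gf n] using g.map_act i _ _ h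

namespace Isomorphic

variable {L : LTS.{u, v, y} P I} {M : LTS.{u, v, w} P I} {N : LTS.{u, v, x} P I}

theorem symm (h : Isomorphic M N) : Isomorphic N M := by
  obtain ⟨f, g, gf, fg⟩ := isomorphic_iff_exists_inverse.1 h
  exact isomorphic_iff_exists_inverse.2 ⟨g, f, fg, gf⟩

theorem trans (h : Isomorphic L M) (h' : Isomorphic M N) : Isomorphic L N := by
  obtain ⟨f, g, gf, fg⟩ := isomorphic_iff_exists_inverse.1 h
  obtain ⟨f', g', gf', fg'⟩ := isomorphic_iff_exists_inverse.1 h'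
  exact isomorphic_iff_exists_inverse.2 ⟨f'.comp f, g.comp g', gf'.comp gf, fg'.comp fg⟩

theorem congr {M' N' : LTS P I} (hM : Isomorphic M M') (hN : Isomorphic N N') :
    Isomorphic M N ↔ Isomorphic M' N' :=
  ⟨fun h => hM.symm.trans (h.trans hN), fun h => hM.trans (h.trans hN.symm)⟩

theorem truncate (h : Isomorphic M N) (k : ℕ) : Isomorphic (M.truncate k) (N.truncate k) := by
  obtain ⟨f, g, gf, fg⟩ := isomorphic_iff_exists_inverse.1 h
  exact isomorphic_iff_exists_inverse.2 ⟨f.truncate k, g.truncate k,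
    fun m => Subtype.ext (gf m.1), fun n => Subtype.ext (fg n.1)⟩

theorem homCount_eq (h : Isomorphic M N) (T : LTS.{u, v, y} P I) :
    homCount T M = homCount T N := by
  obtain ⟨f, g, gf, fg⟩ := isomorphic_iff_exists_inverse.1 h
  exact Nat.card_congr ⟨f.comp, g.comp, fun t => Hom.ext fun s => gf (t.toFun s),
    fun t => Hom.ext fun s => fg (t.toFun s)⟩

end Isomorphic

/-! ### Trees -/

namespace IsTree

variable {T : LTS.{u, v, y} P I} (hT : T.IsTree)

/-- The unique directed path from the root of a tree to a given state. -/
noncomputable def path (t : T.State) : List (I × T.State) :=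
  (hT t).choose

theorem isPath_path (t : T.State) : T.IsPath T.root (hT.path t) t :=
  (hT t).choose_spec.1

theorem eq_path {l : List (I × T.State)} {t : T.State} (h : T.IsPath T.root l t) :
    l = hT.path t :=
  (hT t).unique h (hT.isPath_path t)

theorem path_root : hT.path T.root = [] :=
  (hT.eq_path (show T.IsPath T.root [] T.root from rfl)).symm

theorem path_of_act {i : I} {s t : T.State} (h : T.act i s t) :
    hT.path t = hT.path s ++ [(i, t)] :=
  (hT.eq_path (T.isPath_concat.2 ⟨s, hT.isPath_path s, h, rfl⟩)).symm

theorem depthOf_eq (t : T.State) : T.depthOf t = (hT.path t).length :=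
  (depthOf_le_of_isPath (hT.isPath_path t)).antisymm
    (le_iInf₂ fun _ h => by rw [hT.eq_path h])

theorem of_path {M : LTS.{u, v, w} P I} (π : M.State → List (I × M.State))
    (isPath : ∀ m, M.IsPath M.root (π m) m) (root : π M.root = [])
    (act : ∀ i m n, M.act i m n → π n = π m ++ [(i, n)]) : M.IsTree := by
  refine fun m => ⟨π m, isPath m, fun l h => ?_⟩
  induction l using List.reverseRecOn generalizing m with
  | nil => obtain rfl : M.root = m := h; exact root.symm
  | append_singleton l a ih =>
    obtain ⟨s, hs, hact, rfl⟩ := M.isPath_concat.1 h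
    rw [act _ _ _ hact, ← ih s hs]

include hT in
theorem finite_hom [Finite T.State] {M : LTS.{u, v, w} P I} (hM : M.LocallyFinite) :
    Finite (Hom T M) := by
  let endpoints (t : T.State) : Set M.State :=
    {n | ∃ l, l.map Prod.fst = (hT.path t).map Prod.fst ∧ M.IsPath M.root l n}
  have finite_endpoints (t) : Finite (endpoints t) := hM.finite_setOf_isPath _ _
  have mem_endpoints (f : Hom T M) (t) : f.toFun t ∈ endpoints t :=
    ⟨_, by simp [mapPath], f.isPath (hT.isPath_path t)⟩
  exact Finite.of_injective (β := ∀ t, endpoints t) (fun f t => ⟨f.toFun t, mem_endpoints f t⟩)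
    fun f g h => Hom.ext fun t => congrArg Subtype.val (congrFun h t)

end IsTree

/-! ### Unravelings -/

/-- The projection of an unraveling to the last states of its paths. -/
def lastState (M : LTS.{u, v, w} P I) : Hom M.unravel M where
  toFun q := q.1.2
  map_root := rfl
  map_prop _ _ h := h
  map_act _ _ _ h := h.1

theorem unravel_ext {M : LTS.{u, v, w} P I} {q r : M.unravel.State} (h : q.1.1 = r.1.1) :
    q = r :=
  Subtype.ext (Prod.ext h (q.2.unique (h ▸ r.2)))

theorem eq_mapPath_of_isPath_unravel {M : LTS.{u, v, w} P I} {l : List (I × M.unravel.State)}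
    {q : M.unravel.State} (h : M.unravel.IsPath M.unravel.root l q) :
    q.1.1 = mapPath M.lastState.toFun l := by
  induction l using List.reverseRecOn generalizing q with
  | nil => cases h; rfl
  | append_singleton l a ih =>
    obtain ⟨r, hr, hact, rfl⟩ := M.unravel.isPath_concat.1 h
    rw [mapPath_concat, ← ih hr]
    exact hact.2

theorem exists_isPath_unravel {M : LTS.{u, v, w} P I} {l : List (I × M.State)} {m : M.State}
    (h : M.IsPath M.root l m) : ∃ l', M.unravel.IsPath M.unravel.root l' ⟨(l, m), h⟩ := by
  induction l using List.reverseRecOn generalizing m with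
  | nil => cases h; exact ⟨[], rfl⟩
  | append_singleton l a ih =>
    obtain ⟨s, hs, hact, rfl⟩ := M.isPath_concat.1 h
    obtain ⟨l', hl'⟩ := ih hs
    exact ⟨l' ++ [(a.1, ⟨(_, a.2), h⟩)],
      M.unravel.isPath_concat.2 ⟨_, hl', ⟨hact, rfl⟩, rfl⟩⟩

theorem depthOf_unravel {M : LTS.{u, v, w} P I} (q : M.unravel.State) :
    M.unravel.depthOf q = q.1.1.length := by
  have length_eq {l} (h : M.unravel.IsPath M.unravel.root l q) : q.1.1.length = l.length := by
    rw [eq_mapPath_of_isPath_unravel h, length_mapPath]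
  obtain ⟨l, hl⟩ := exists_isPath_unravel q.2
  refine le_antisymm ((depthOf_le_of_isPath hl).trans_eq (by rw [length_eq hl])) ?_
  exact le_iInf₂ fun l h => by rw [length_eq h]

theorem depthOf_unravel_le_iff {M : LTS.{u, v, w} P I} {q : M.unravel.State} {k : ℕ} :
    M.unravel.depthOf q ≤ k ↔ q.1.1.length ≤ k := by
  rw [depthOf_unravel, Nat.cast_le]

/-- Homomorphisms from a tree lift uniquely to the unraveling: a state is sent to the image of the
path that leads to it. -/
noncomputable def IsTree.homUnravelEquiv {T : LTS.{u, v, y} P I} (hT : T.IsTree)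
    (M : LTS.{u, v, w} P I) : Hom T M.unravel ≃ Hom T M where
  toFun := M.lastState.comp
  invFun f :=
    { toFun t := ⟨(mapPath f.toFun (hT.path t), f.toFun t), f.isPath (hT.isPath_path t)⟩
      map_root := unravel_ext (congrArg (mapPath f.toFun) hT.path_root)
      map_prop := f.map_prop
      map_act i s t h := by
        refine ⟨f.map_act i s t h, ?_⟩
        simp only [hT.path_of_act h, mapPath_concat] }
  left_inv f := by
    refine Hom.ext fun t => unravel_ext ?_
    exact (eq_mapPath_of_isPath_unravel (f.isPath (hT.isPath_path t))).trans List.map_map |>.symm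
  right_inv _ := rfl

/-- Homomorphisms do not increase depths, so those from an LTS of depth at most `k` only reach
states of depth at most `k`. -/
def homTruncateEquiv {L : LTS.{u, v, y} P I} {k : ℕ} (hk : L.depth ≤ k)
    (M : LTS.{u, v, w} P I) : Hom L (M.truncate k) ≃ Hom L M where
  toFun f := ⟨fun s => (f.toFun s).1, congrArg Subtype.val f.map_root, f.map_prop, f.map_act⟩
  invFun f := ⟨fun s => ⟨f.toFun s, (f.depthOf_le s).trans ((le_iSup L.depthOf s).trans hk)⟩,
    Subtype.ext f.map_root, f.map_prop, f.map_act⟩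
  left_inv _ := rfl
  right_inv _ := rfl

theorem IsTree.homCount_unravel_truncate {T : LTS.{u, v, y} P I} (hT : T.IsTree) {k : ℕ}
    (hk : T.depth ≤ k) (M : LTS.{u, v, w} P I) :
    homCount T (M.unravel.truncate k) = homCount T M :=
  Nat.card_congr ((homTruncateEquiv hk _).trans (hT.homUnravelEquiv M))

/-! ### Gluing rooted systems below a new root -/

/-- The transitions of `node`. -/
inductive NodeAct {J : Type z} (lab : J → I) (T : J → LTS.{u, v, y} P I) :
    I → Option (Σ j, (T j).State) → Option (Σ j, (T j).State) → Prop
  | root (j : J) : NodeAct lab T (lab j) none (some ⟨j, (T j).root⟩)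
  | sub {j : J} {i : I} {s t : (T j).State} (h : (T j).act i s t) :
      NodeAct lab T i (some ⟨j, s⟩) (some ⟨j, t⟩)

/-- The LTS with a new root that satisfies the letters in `A` and has, for each `j`, a
`lab j`-transition to the root of a copy of `T j`. -/
def node {J : Type z} (A : Set P) (lab : J → I) (T : J → LTS.{u, v, y} P I) :
    LTS.{u, v, max y z} P I where
  State := Option (Σ j, (T j).State)
  root := none
  prop p
    | none => p ∈ A
    | some q => (T q.1).prop p q.2
  act := NodeAct lab T

section Node

variable {J : Type z} {A : Set P} {lab : J → I} {T : J → LTS.{u, v, y} P I}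

/-- The inclusion of the copy of `T j`. -/
def nodeSub (A : Set P) (lab : J → I) (T : J → LTS.{u, v, y} P I) (j : J) (t : (T j).State) :
    (node A lab T).State :=
  some ⟨j, t⟩

theorem act_node_root {i : I} {r : (node A lab T).State} :
    (node A lab T).act i (node A lab T).root r ↔
      ∃ j, i = lab j ∧ r = nodeSub A lab T j (T j).root := by
  constructor
  · rintro (j | _)
    exact ⟨j, rfl, rfl⟩
  · rintro ⟨j, rfl, rfl⟩
    exact .root j

theorem act_nodeSub {i : I} {j : J} {s : (T j).State} {r : (node A lab T).State} :
    (node A lab T).act i (nodeSub A lab T j s) r ↔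
      ∃ t, (T j).act i s t ∧ r = nodeSub A lab T j t := by
  constructor
  · rintro (_ | h)
    exact ⟨_, h, rfl⟩
  · rintro ⟨t, h, rfl⟩
    exact .sub h

/-- The directed path to a state of `node` when each `T j` is a tree. -/
noncomputable def nodePath (hT : ∀ j, (T j).IsTree) :
    (r : (node A lab T).State) → List (I × (node A lab T).State)
  | none => []
  | some ⟨j, t⟩ =>
    (lab j, nodeSub A lab T j (T j).root) :: mapPath (nodeSub A lab T j) ((hT j).path t)

theorem isPath_nodePath (hT : ∀ j, (T j).IsTree) :
    ∀ r, (node A lab T).IsPath (node A lab T).root (nodePath hT r) r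
  | none => rfl
  | some ⟨j, t⟩ => ⟨.root j, ((hT j).isPath_path t).map fun _ _ _ => NodeAct.sub⟩

theorem isTree_node (hT : ∀ j, (T j).IsTree) : (node A lab T).IsTree := by
  refine .of_path (nodePath hT) (isPath_nodePath hT) rfl ?_
  rintro i _ _ (j | h)
  · simp [nodePath, (hT j).path_root, mapPath, nodeSub]
  · simp [nodePath, (hT _).path_of_act h, mapPath_concat, nodeSub]

theorem depth_node_le (hT : ∀ j, (T j).IsTree) {k : ℕ} (hk : ∀ j, (T j).depth + 1 ≤ k) :
    (node A lab T).depth ≤ k := by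
  refine iSup_le fun r => (depthOf_le_of_isPath (isPath_nodePath hT r)).trans ?_
  match r with
  | none => exact bot_le
  | some ⟨j, t⟩ =>
    calc ((nodePath hT (some ⟨j, t⟩)).length : ℕ∞)
      _ = (T j).depthOf t + 1 := by simp [nodePath, length_mapPath, (hT j).depthOf_eq]
      _ ≤ (T j).depth + 1 := by gcongr; exact le_iSup (T j).depthOf t
      _ ≤ k := hk j

theorem isomorphic_node {J' : Type z'} {T' : J' → LTS.{u, v, x} P I} {lab' : J' → I} (e : J ≃ J')
    (hlab : ∀ j, lab' (e j) = lab j) (hT : ∀ j, Isomorphic (T j) (T' (e j))) :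
    Isomorphic (node A lab T) (node A lab' T') := by
  choose f hroot hprop hact using hT
  let E : (node A lab T).State ≃ (node A lab' T').State := (Equiv.sigmaCongr e f).optionCongr
  refine ⟨E, rfl, ?_, fun i r r' => ⟨?_, fun h => ?_⟩⟩
  · rintro p (_ | ⟨j, t⟩)
    exacts [Iff.rfl, hprop j p t]
  · rintro (j | h)
    · exact act_node_root.2 ⟨e j, (hlab j).symm, congrArg (nodeSub A lab' T' (e j)) (hroot j)⟩
    · exact .sub ((hact _ _ _ _).1 h)
  · suffices lift : ∃ r'', (node A lab T).act i r r'' ∧ E r' = E r'' by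
      obtain ⟨r'', h, hr⟩ := lift
      rwa [E.injective hr]
    match r with
    | none =>
      obtain ⟨j', rfl, hr⟩ := act_node_root.1 h
      obtain ⟨j, rfl⟩ := e.surjective j'
      refine ⟨_, act_node_root.2 ⟨j, hlab j, rfl⟩, hr.trans ?_⟩
      exact congrArg (nodeSub A lab' T' (e j)) (hroot j).symm
    | some ⟨j, s⟩ =>
      obtain ⟨t', ht, hr⟩ := act_nodeSub.1 h
      obtain ⟨t, rfl⟩ := (f j).surjective t'
      exact ⟨_, .sub ((hact j i s t).2 ht), hr⟩

/-- A homomorphism from `node A lab T` to a state satisfying the letters in `A` consists of an image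
of each root of a subtree and homomorphisms from the subtrees. -/
def nodeHomEquiv {M : LTS.{u, v, w} P I} {m : M.State} (hA : ∀ p ∈ A, M.prop p m) :
    Hom (node A lab T) (M.withRoot m) ≃
      ∀ j, Σ s : {s // M.act (lab j) m s}, Hom (T j) (M.withRoot s.1) where
  toFun f j := ⟨⟨f.toFun (nodeSub A lab T j (T j).root), f.act_of_act_root (.root j)⟩,
    { toFun t := f.toFun (nodeSub A lab T j t)
      map_root := rfl
      map_prop p t := f.map_prop p (nodeSub A lab T j t)
      map_act i s t h := f.map_act i _ _ (.sub h) }⟩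
  invFun g :=
    { toFun
        | none => m
        | some q => (g q.1).2.toFun q.2
      map_root := rfl
      map_prop := by
        rintro p (_ | ⟨j, t⟩) h
        exacts [hA p h, (g j).2.map_prop p t h]
      map_act := by
        rintro i _ _ (j | h)
        · have act_root : M.act (lab j) m ((g j).2.toFun (T j).root) := by
            rw [(g j).2.toFun_root]
            exact (g j).1.2
          exact act_root
        · exact (g _).2.map_act i _ _ h }
  left_inv f := by
    refine Hom.ext ?_
    rintro (_ | q)
    exacts [f.map_root.symm, rfl]
  right_inv _ := funext fun _ => Hom.sigma_ext rfl

open Classical in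
theorem homCount_node [Fintype J] {M : LTS.{u, v, w} P I} (hM : M.LocallyFinite) (m : M.State)
    (hT : ∀ j s, Finite (Hom (T j) (M.withRoot s))) :
    homCount (node A lab T) (M.withRoot m) = (if ∀ p ∈ A, M.prop p m then 1 else 0) *
      ∏ j, ∑ᶠ s : {s // M.act (lab j) m s}, homCount (T j) (M.withRoot s) := by
  split_ifs with hA
  · rw [one_mul, homCount, Nat.card_congr (nodeHomEquiv hA), Nat.card_pi]
    refine Finset.prod_congr rfl fun j _ => ?_
    have := hM (lab j) m
    have := Fintype.ofFinite {s // M.act (lab j) m s}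
    rw [Nat.card_sigma, finsum_eq_sum_of_fintype]
    rfl
  · rw [zero_mul]
    have : IsEmpty (Hom (node A lab T) (M.withRoot m)) :=
      ⟨fun f => hA fun p hp => f.prop_of_prop_root hp⟩
    exact Nat.card_of_isEmpty

end Node

/-! ### The first step of an unraveling -/

/-- The unravelings of the successors of the root, up to depth `k`, glued below a new root. -/
abbrev unravelNode (M : LTS.{u, v, w} P I) (k : ℕ) : LTS.{u, v, max v w} P I :=
  node {p | M.prop p M.root} Sigma.fst
    fun q : Σ i, {s // M.act i M.root s} => (M.withRoot q.2).unravel.truncate k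

/-- Splitting off the first step of a path. -/
def unravelTail (M : LTS.{u, v, w} P I) (k : ℕ) :
    Hom (M.unravel.truncate (k + 1)) (M.unravelNode k) where
  toFun
    | ⟨⟨([], _), _⟩, _⟩ => none
    | ⟨⟨((i, s) :: l, t), h⟩, hk⟩ => some ⟨⟨i, s, h.1⟩, ⟨(l, t), M.isPath_withRoot.2 h.2⟩,
        depthOf_unravel_le_iff.2 (Nat.le_of_succ_le_succ (depthOf_unravel_le_iff.1 hk))⟩
  map_root := rfl
  map_prop := by
    rintro p ⟨⟨⟨_ | _, t⟩, h⟩, hk⟩ hp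
    · obtain rfl : M.root = t := h
      exact hp
    · exact hp
  map_act := by
    rintro i ⟨⟨⟨_ | ⟨⟨j, s⟩, l⟩, t⟩, h⟩, hk⟩ ⟨⟨⟨l', t'⟩, h'⟩, hk'⟩ ⟨hact, hl'⟩
    · obtain rfl : M.root = t := h
      obtain rfl : l' = [(i, t')] := hl'
      exact .root (⟨i, t', hact⟩ : Σ i, {s // M.act i M.root s})
    · obtain rfl : l' = (j, s) :: (l ++ [(i, t')]) := hl'
      exact .sub ⟨hact, rfl⟩

/-- Prepending a first step to a path. -/
def unravelCons (M : LTS.{u, v, w} P I) (k : ℕ) :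
    Hom (M.unravelNode k) (M.unravel.truncate (k + 1)) where
  toFun
    | none => (M.unravel.truncate (k + 1)).root
    | some ⟨⟨i, s, h⟩, ⟨⟨(l, t), hl⟩, hk⟩⟩ => ⟨⟨((i, s) :: l, t), h, M.isPath_withRoot.1 hl⟩,
        depthOf_unravel_le_iff.2 (Nat.succ_le_succ (depthOf_unravel_le_iff.1 hk))⟩
  map_root := rfl
  map_prop := by
    rintro p (_ | _) hp
    exacts [hp, hp]
  map_act := by
    rintro i _ _ (⟨i, s, h⟩ | h)
    exacts [⟨h, rfl⟩, ⟨h.1, congrArg (List.cons _) h.2⟩]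

theorem isomorphic_unravel_truncate_succ (M : LTS.{u, v, w} P I) (k : ℕ) :
    Isomorphic (M.unravel.truncate (k + 1)) (M.unravelNode k) := by
  refine isomorphic_iff_exists_inverse.2 ⟨M.unravelTail k, M.unravelCons k, ?_, ?_⟩
  · rintro ⟨⟨⟨_ | _, t⟩, h⟩, hk⟩
    · obtain rfl : M.root = t := h
      rfl
    · rfl
  · rintro (_ | _) <;> rfl

theorem eq_root_of_unravel_truncate_zero {M : LTS.{u, v, w} P I}
    (q : (M.unravel.truncate 0).State) : q = (M.unravel.truncate 0).root :=
  Subtype.ext <| unravel_ext <|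
    List.length_eq_zero_iff.1 (Nat.le_zero.1 (depthOf_unravel_le_iff.1 q.2))

theorem not_act_unravel_truncate_zero {M : LTS.{u, v, w} P I} (i : I)
    (q r : (M.unravel.truncate 0).State) : ¬ (M.unravel.truncate 0).act i q r := by
  rw [eq_root_of_unravel_truncate_zero q, eq_root_of_unravel_truncate_zero r]
  exact fun h => List.cons_ne_nil _ _ h.2.symm

theorem isomorphic_unravel_truncate_zero {M : LTS.{u, v, w} P I} {N : LTS.{u, v, x} P I}
    (h : ∀ p, M.prop p M.root ↔ N.prop p N.root) :
    Isomorphic (M.unravel.truncate 0) (N.unravel.truncate 0) := by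
  refine ⟨⟨fun _ => (N.unravel.truncate 0).root, fun _ => (M.unravel.truncate 0).root,
    fun q => (eq_root_of_unravel_truncate_zero q).symm,
    fun r => (eq_root_of_unravel_truncate_zero r).symm⟩, rfl, fun p q => ?_, fun i q r =>
    iff_of_false (not_act_unravel_truncate_zero i q r) (not_act_unravel_truncate_zero i _ _)⟩
  rw [eq_root_of_unravel_truncate_zero q]
  exact h p

/-! ### Graded bisimilarity -/

/-- Depth-`k` graded bisimilarity: the states satisfy the same letters and, for `k > 0`, their
`i`-successors can be matched bijectively with `(k - 1)`-bisimilar ones, for each action `i`. -/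
def GradedBisim (M : LTS.{u, v, w} P I) (N : LTS.{u, v, x} P I) : ℕ → M.State → N.State → Prop
  | 0, m, n => ∀ p, M.prop p m ↔ N.prop p n
  | k + 1, m, n => (∀ p, M.prop p m ↔ N.prop p n) ∧
      ∀ i, ∃ e : {s // M.act i m s} ≃ {t // N.act i n t},
        ∀ s : {s // M.act i m s}, GradedBisim M N k s (e s)

namespace GradedBisim

variable {M : LTS.{u, v, w} P I} {N : LTS.{u, v, x} P I}

theorem prop_iff {k : ℕ} {m : M.State} {n : N.State} (h : GradedBisim M N k m n) (p : P) :
    M.prop p m ↔ N.prop p n :=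
  match k with
  | 0 => h p
  | _ + 1 => h.1 p

theorem isomorphic_unravel_truncate {k : ℕ} {m : M.State} {n : N.State}
    (h : GradedBisim M N k m n) :
    Isomorphic ((M.withRoot m).unravel.truncate k) ((N.withRoot n).unravel.truncate k) := by
  induction k generalizing m n with
  | zero => exact isomorphic_unravel_truncate_zero h
  | succ k ih =>
    choose e he using h.2
    refine (Isomorphic.congr (isomorphic_unravel_truncate_succ _ k)
      (isomorphic_unravel_truncate_succ _ k)).2 ?_
    have same_letters : {p | M.prop p m} = {p | N.prop p n} := Set.ext h.1
    change Isomorphic (node {p | M.prop p m} _ _) (node {p | N.prop p n} _ _)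
    rw [same_letters]
    exact isomorphic_node (Equiv.sigmaCongrRight e) (fun _ => rfl) fun q => ih (he q.1 q.2)

theorem exists_matching {d k : ℕ} {m : M.State} {n : N.State} (h : GradedBisim M N k m n)
    (hd : d + 1 ≤ k) (i : I) : ∃ j ≥ d, ∃ e : {s // M.act i m s} ≃ {t // N.act i n t},
      ∀ s : {s // M.act i m s}, GradedBisim M N j s (e s) := by
  obtain ⟨j, rfl⟩ := Nat.exists_eq_add_of_le' hd
  exact ⟨j + d, Nat.le_add_left d j, h.2 i⟩

theorem sat_iff {k : ℕ} {m : M.State} {n : N.State} (h : GradedBisim M N k m n) {φ : GML P I}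
    (hφ : φ.modalDepth ≤ k) : GML.Sat M m φ ↔ GML.Sat N n φ := by
  induction φ generalizing k m n with
  | top => rfl
  | letter p => exact h.prop_iff p
  | neg φ ih => exact not_congr (ih h hφ)
  | and φ ψ ihφ ihψ =>
    exact and_congr (ihφ h (le_of_max_le_left hφ)) (ihψ h (le_of_max_le_right hφ))
  | or φ ψ ihφ ihψ =>
    exact or_congr (ihφ h (le_of_max_le_left hφ)) (ihψ h (le_of_max_le_right hφ))
  | dia i φ ih =>
    obtain ⟨j, hj, e, he⟩ := h.exists_matching hφ i
    simpa only [GML.Sat, Subtype.exists, exists_prop] using e.exists_congr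
      (p := fun s : {s // M.act i m s} => GML.Sat M s φ)
      (q := fun t : {t // N.act i n t} => GML.Sat N t φ) fun s => ih (he s) hj
  | box i φ ih =>
    obtain ⟨j, hj, e, he⟩ := h.exists_matching hφ i
    simpa only [GML.Sat, Subtype.forall] using e.forall_congr
      (p := fun s : {s // M.act i m s} => GML.Sat M s φ)
      (q := fun t : {t // N.act i n t} => GML.Sat N t φ) fun {s} => ih (he s) hj
  | gdia c i φ ih =>
    obtain ⟨j, hj, e, he⟩ := h.exists_matching hφ i
    have sat_equiv : {s : {s // M.act i m s} // GML.Sat M s φ} ≃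
        {t : {t // N.act i n t} // GML.Sat N t φ} := e.subtypeEquiv fun s => ih (he s) hj
    have encard_eq : {s | M.act i m s ∧ GML.Sat M s φ}.encard =
        {t | N.act i n t ∧ GML.Sat N t φ}.encard :=
      Set.encard_congr <| ((Equiv.subtypeSubtypeEquivSubtypeInter _ _).symm.trans sat_equiv).trans
        (Equiv.subtypeSubtypeEquivSubtypeInter _ _)
    rw [GML.Sat, GML.Sat, encard_eq]

end GradedBisim

end LTS

/-! ### Graded modal logic -/

namespace GML

variable {P : Type u} {I : Type v}

/-- The formulas of modal depth at most `k` that hold at a state. -/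
def theory (k : ℕ) (M : LTS.{u, v, w} P I) (m : M.State) : Set (GML P I) :=
  {φ | φ.modalDepth ≤ k ∧ Sat M m φ}

variable {M : LTS.{u, v, w} P I} {N : LTS.{u, v, x} P I} {k : ℕ}

theorem theory_eq_iff {m : M.State} {n : N.State} : theory k M m = theory k N n ↔
    ∀ φ : GML P I, φ.modalDepth ≤ k → (Sat M m φ ↔ Sat N n φ) := by
  simp only [Set.ext_iff, theory, Set.mem_ofPred_eq, and_congr_right_iff]

theorem exists_sat_of_theory_ne {m : M.State} {n : N.State} (h : theory k M m ≠ theory k N n) :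
    ∃ φ : GML P I, φ.modalDepth ≤ k ∧ Sat M m φ ∧ ¬ Sat N n φ := by
  rw [Ne, theory_eq_iff] at h
  push Not at h
  obtain ⟨φ, hφ, ⟨hm, hn⟩ | ⟨hm, hn⟩⟩ := h
  · exact ⟨φ, hφ, hm, hn⟩
  · exact ⟨neg φ, hφ, hm, not_not.2 hn⟩

theorem exists_formula_isolating_theory {S : Set N.State} (hS : S.Finite) (m : M.State) :
    ∃ φ : GML P I, φ.modalDepth ≤ k ∧ Sat M m φ ∧
      ∀ n ∈ S, Sat N n φ → theory k M m = theory k N n := by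
  induction S, hS using Set.Finite.induction_on with
  | empty => exact ⟨top, Nat.zero_le k, trivial, by simp⟩
  | @insert n S _ _ ih =>
    obtain ⟨φ, hφ, hm, hS⟩ := ih
    by_cases h : theory k M m = theory k N n
    · refine ⟨φ, hφ, hm, fun n' hn' hsat => ?_⟩
      obtain rfl | hn' := hn'
      exacts [h, hS n' hn' hsat]
    · obtain ⟨ψ, hψ, hmψ, hnψ⟩ := exists_sat_of_theory_ne h
      refine ⟨and φ ψ, max_le hφ hψ, ⟨hm, hmψ⟩, fun n' hn' hsat => ?_⟩
      obtain rfl | hn' := hn'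
      exacts [absurd hsat.2 hnψ, hS n' hn' hsat.1]

theorem encard_theory_le {m : M.State} {n : N.State}
    (hN : N.LocallyFinite) (h : theory (k + 1) M m = theory (k + 1) N n) (i : I)
    (τ : Set (GML P I)) : {s | M.act i m s ∧ theory k M s = τ}.encard ≤
      {t | N.act i n t ∧ theory k N t = τ}.encard := by
  obtain empty | ⟨s, -, rfl⟩ := Set.eq_empty_or_nonempty {s | M.act i m s ∧ theory k M s = τ}
  · simp [empty]
  have finite_act : {t | N.act i n t}.Finite := hN i n
  obtain ⟨φ, hφ, hs, eq_of_sat⟩ := exists_formula_isolating_theory (k := k) finite_act s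
  rw [theory_eq_iff] at h
  refine ENat.forall_natCast_le_iff_le.1 fun c hc => ?_
  obtain rfl | c_pos := Nat.eq_zero_or_pos c
  · exact bot_le
  have hgdia : Sat M m (gdia ⟨c, c_pos⟩ i φ) := hc.trans <| Set.encard_le_encard
    fun s' hs' => ⟨hs'.1, ((theory_eq_iff.1 hs'.2) φ hφ).2 hs⟩
  exact ((h (gdia ⟨c, c_pos⟩ i φ) (Nat.succ_le_succ hφ)).1 hgdia).trans <|
    Set.encard_le_encard fun t ht => ⟨ht.1, (eq_of_sat t ht.1 ht.2).symm⟩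

theorem exists_matching_of_theory_eq {m : M.State} {n : N.State} (hM : M.LocallyFinite)
    (hN : N.LocallyFinite) (h : theory (k + 1) M m = theory (k + 1) N n) (i : I) :
    ∃ e : {s // M.act i m s} ≃ {t // N.act i n t},
      ∀ s : {s // M.act i m s}, theory k N (e s) = theory k M s := by
  have := hM i m
  have := hN i n
  refine exists_equiv_of_card_fiber_eq (α := {s // M.act i m s}) (β := {t // N.act i n t})
    (f := fun s => theory k M s) (g := fun t => theory k N t) fun τ => ?_
  have encard_eq := (encard_theory_le hN h i τ).antisymm (encard_theory_le hM h.symm i τ)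
  rw [Nat.card_congr (Equiv.subtypeSubtypeEquivSubtypeInter _ (theory k M · = τ)),
    Nat.card_congr (Equiv.subtypeSubtypeEquivSubtypeInter _ (theory k N · = τ))]
  exact congrArg ENat.toNat encard_eq

theorem gradedBisim_of_theory_eq (hM : M.LocallyFinite) (hN : N.LocallyFinite) {m : M.State}
    {n : N.State} (h : theory k M m = theory k N n) : M.GradedBisim N k m n := by
  induction k generalizing m n with
  | zero => exact fun p => theory_eq_iff.1 h (letter p) le_rfl
  | succ k ih =>
    refine ⟨fun p => theory_eq_iff.1 h (letter p) (Nat.zero_le _), fun i => ?_⟩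
    obtain ⟨e, he⟩ := exists_matching_of_theory_eq hM hN h i
    exact ⟨e, fun s => ih (he s).symm⟩

theorem equivUpTo_iff_gradedBisim (hM : M.LocallyFinite) (hN : N.LocallyFinite) :
    EquivUpTo k M N ↔ M.GradedBisim N k M.root N.root :=
  ⟨fun h => gradedBisim_of_theory_eq hM hN (theory_eq_iff.2 h), fun h _ => h.sat_iff⟩

end GML

namespace LTS

variable {P : Type u} {I : Type v}

/-! ### Counting homomorphisms from finite trees -/

/-- Words of letters and of labeled finite trees of depth less than `k`. Such a pair describes a
tree of depth at most `k`; multiplying pairs corresponds to gluing the trees at their roots. -/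
abbrev TreeWord (P : Type u) (I : Type v) (k : ℕ) : Type (max u v (y + 1)) :=
  FreeMonoid P × FreeMonoid (I × {T : LTS.{u, v, y} P I //
    Finite T.State ∧ T.IsTree ∧ T.depth + 1 ≤ k})

namespace TreeWord

variable {M : LTS.{u, v, w} P I} {N : LTS.{u, v, x} P I} {k : ℕ}

/-- The tree whose root satisfies the letters and has the subtrees listed in a word. -/
def toLTS (s : TreeWord.{u, v, y} P I k) : LTS.{u, v, y} P I :=
  node (J := Fin s.2.toList.length) {p | p ∈ s.1} (fun j => s.2.toList[j].1)
    fun j => s.2.toList[j].2.1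

theorem toLTS_mem_finiteTrees (s : TreeWord.{u, v, y} P I k) : s.toLTS ∈ finiteTrees P I k := by
  refine ⟨?_, isTree_node fun j => s.2.toList[j].2.2.2.1,
    depth_node_le (fun j => s.2.toList[j].2.2.2.1) fun j => s.2.toList[j].2.2.2.2⟩
  have (j : Fin s.2.toList.length) : Finite s.2.toList[j].2.1.State := s.2.toList[j].2.2.1
  exact inferInstanceAs (Finite (Option (Σ j : Fin s.2.toList.length, _)))

open Classical in
/-- The number of homomorphisms to a given state as a function of the word. It is a character: a
homomorphism from two trees glued at their roots is a pair of homomorphisms. -/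
noncomputable def homCountHom (k : ℕ) (M : LTS.{u, v, w} P I) (m : M.State) :
    TreeWord.{u, v, y} P I k →* ℕ :=
  (FreeMonoid.lift fun p => if M.prop p m then 1 else 0).coprod <| FreeMonoid.lift fun c =>
    ∑ᶠ t : {t // M.act c.1 m t}, homCount c.2.1 (M.withRoot t)

open Classical in
theorem homCount_toLTS (hM : M.LocallyFinite) (s : TreeWord.{u, v, y} P I k) (m : M.State) :
    homCount s.toLTS (M.withRoot m) = homCountHom k M m s := by
  have finite_hom (j : Fin s.2.toList.length) (t : M.State) :
      Finite (Hom s.2.toList[j].2.1 (M.withRoot t)) :=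
    have := s.2.toList[j].2.2.1
    s.2.toList[j].2.2.2.1.finite_hom hM
  rw [toLTS, homCount_node hM m finite_hom, homCountHom, MonoidHom.coprod_apply,
    freeMonoid_lift_ite_one_zero, FreeMonoid.lift_apply, ← Fin.prod_univ_fun_getElem]
  rfl

theorem homCountHom_of_letter (m : M.State) (p : P) [Decidable (M.prop p m)] :
    homCountHom.{u, v, w, y} k M m (FreeMonoid.of p, 1) = if M.prop p m then 1 else 0 := by
  simp only [homCountHom, MonoidHom.coprod_apply, FreeMonoid.lift_eval_of, map_one, mul_one]
  congr

theorem homCountHom_of_subtree (hM : M.LocallyFinite) (m : M.State) (i : I)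
    (s : TreeWord.{u, v, y} P I k) :
    homCountHom (k + 1) M m (1, FreeMonoid.of (i, ⟨s.toLTS, s.toLTS_mem_finiteTrees.1,
      s.toLTS_mem_finiteTrees.2.1, add_le_add_left s.toLTS_mem_finiteTrees.2.2 1⟩)) =
      ∑ᶠ t : {t // M.act i m t}, homCountHom k M t s := by
  simp only [homCountHom, MonoidHom.coprod_apply, FreeMonoid.lift_eval_of, map_one, one_mul]
  simp only [homCount_toLTS hM]
  rfl

theorem prop_iff_of_homCountHom_eq {m : M.State} {n : N.State}
    (h : homCountHom.{u, v, w, y} k M m = homCountHom.{u, v, x, y} k N n) (p : P) :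
    M.prop p m ↔ N.prop p n := by
  classical
  have count_eq := DFunLike.congr_fun h (FreeMonoid.of p, 1)
  rw [homCountHom_of_letter, homCountHom_of_letter] at count_eq
  by_cases hm : M.prop p m <;> by_cases hn : N.prop p n <;> simp_all

theorem exists_matching_of_homCountHom_eq (hM : M.LocallyFinite) (hN : N.LocallyFinite)
    {m : M.State} {n : N.State}
    (h : homCountHom.{u, v, w, y} (k + 1) M m = homCountHom.{u, v, x, y} (k + 1) N n) (i : I) :
    ∃ e : {s // M.act i m s} ≃ {t // N.act i n t}, ∀ s : {s // M.act i m s},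
      homCountHom.{u, v, x, y} k N (e s) = homCountHom.{u, v, w, y} k M s := by
  have := hM i m
  have := hN i n
  let toInt := (Nat.castRingHom ℤ).toMonoidHom
  obtain ⟨e, he⟩ := exists_equiv_of_finsum_monoidHom_eq
    (χ := fun s : {s // M.act i m s} => toInt.comp (homCountHom.{u, v, w, y} k M s))
    (ψ := fun t : {t // N.act i n t} => toInt.comp (homCountHom.{u, v, x, y} k N t)) fun s => by
      have count_eq : ∑ᶠ t : {t // M.act i m t}, homCountHom k M t s =
          ∑ᶠ t : {t // N.act i n t}, homCountHom k N t s := by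
        rw [← homCountHom_of_subtree hM, ← homCountHom_of_subtree hN, h]
      have cast_eq := congrArg (Nat.cast : ℕ → ℤ) count_eq
      rwa [Nat.cast_finsum, Nat.cast_finsum] at cast_eq
  exact ⟨e, fun s => (MonoidHom.cancel_left Nat.cast_injective).1 (he s)⟩

theorem gradedBisim_of_homCountHom_eq (hM : M.LocallyFinite) (hN : N.LocallyFinite)
    {m : M.State} {n : N.State}
    (h : homCountHom.{u, v, w, y} k M m = homCountHom.{u, v, x, y} k N n) :
    GradedBisim M N k m n := by
  induction k generalizing m n with
  | zero => exact prop_iff_of_homCountHom_eq h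
  | succ k ih =>
    refine ⟨prop_iff_of_homCountHom_eq h, fun i => ?_⟩
    obtain ⟨e, he⟩ := exists_matching_of_homCountHom_eq hM hN h i
    exact ⟨e, fun s => ih (he s).symm⟩

end TreeWord

theorem gradedBisim_of_homCount_eq {M : LTS.{u, v, w} P I} {N : LTS.{u, v, x} P I} {k : ℕ}
    (hM : M.LocallyFinite) (hN : N.LocallyFinite)
    (h : ∀ T ∈ finiteTrees.{u, v, y} P I k, homCount T M = homCount T N) :
    GradedBisim M N k M.root N.root :=
  TreeWord.gradedBisim_of_homCountHom_eq.{u, v, w, x, y} hM hN <| MonoidHom.ext fun s => by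
    rw [← TreeWord.homCount_toLTS hM, ← TreeWord.homCount_toLTS hN]
    exact h _ s.toLTS_mem_finiteTrees

/-! ### The unraveling that records only states -/

theorem IsPath.isChain {M : LTS.{u, v, w} P I} {l : List (I × M.State)} {m n : M.State}
    (h : M.IsPath m l n) : (m :: l.map Prod.snd).IsChain fun s t => ∃ i, M.act i s t := by
  induction l generalizing m with
  | nil => exact List.IsChain.singleton _
  | cons a l ih => exact List.IsChain.cons_cons ⟨_, h.1⟩ (ih h.2)

theorem IsPath.getLast?_eq {M : LTS.{u, v, w} P I} {l : List (I × M.State)} {m n : M.State}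
    (h : M.IsPath m l n) : (m :: l.map Prod.snd).getLast? = some n := by
  induction l generalizing m with
  | nil => cases h; rfl
  | cons a l ih => rw [List.map_cons, List.getLast?_cons_cons]; exact ih h.2

theorem exists_isPath_of_isChain {M : LTS.{u, v, w} P I} {L : List M.State} {m : M.State}
    (h : (m :: L).IsChain fun s t => ∃ i, M.act i s t) :
    ∃ l n, M.IsPath m l n ∧ l.map Prod.snd = L := by
  induction L generalizing m with
  | nil => exact ⟨[], m, rfl, rfl⟩
  | cons s L ih =>
    obtain ⟨⟨i, hi⟩, chain⟩ := List.isChain_cons_cons.1 h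
    obtain ⟨l, n, hl, rfl⟩ := ih chain
    exact ⟨(i, s) :: l, n, ⟨hi, hl⟩, rfl⟩

/-- The map from the unraveling to the one recording only states that forgets the actions taken. -/
def forgetActions (M : LTS.{u, v, w} P I) : Hom M.unravel M.stateUnravel where
  toFun q := ⟨M.root :: q.1.1.map Prod.snd, rfl, q.2.isChain⟩
  map_root := rfl
  map_prop _ q h := ⟨q.1.2, q.2.getLast?_eq, h⟩
  map_act _ q r h := ⟨q.1.2, r.1.2, q.2.getLast?_eq, h.1, by simp [h.2]⟩

theorem forgetActions_surjective (M : LTS.{u, v, w} P I) :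
    Function.Surjective M.forgetActions.toFun := by
  rintro ⟨_ | ⟨m, L⟩, head_eq, chain⟩
  · cases head_eq
  · obtain rfl : m = M.root := Option.some.inj head_eq
    obtain ⟨l, n, hl, rfl⟩ := exists_isPath_of_isChain chain
    exact ⟨⟨(l, n), hl⟩, rfl⟩

namespace DisjointActions

variable {M : LTS.{u, v, w} P I} (hM : M.DisjointActions)
include hM

theorem eq_of_map_snd_eq {l l' : List (I × M.State)} {m n n' : M.State} (h : M.IsPath m l n)
    (h' : M.IsPath m l' n') (states_eq : l.map Prod.snd = l'.map Prod.snd) : l = l' := by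
  induction l generalizing m l' with
  | nil => exact (List.map_eq_nil_iff.1 states_eq.symm).symm
  | cons a l ih =>
    obtain _ | ⟨b, l'⟩ := l'
    · cases states_eq
    obtain ⟨i, s⟩ := a
    obtain ⟨j, t⟩ := b
    obtain ⟨rfl, tail_eq⟩ := List.cons.inj states_eq
    obtain rfl := hM _ _ _ _ h.1 h'.1
    rw [ih h.2 h'.2 tail_eq]

theorem forgetActions_injective : Function.Injective M.forgetActions.toFun := fun q r h =>
  unravel_ext (hM.eq_of_map_snd_eq q.2 r.2 (List.cons.inj (congrArg Subtype.val h)).2)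

theorem isomorphic_stateUnravel : Isomorphic M.unravel M.stateUnravel := by
  have last_unique {q : M.unravel.State} {m : M.State}
      (hm : (M.forgetActions.toFun q).1.getLast? = some m) : q.1.2 = m :=
    Option.some.inj (q.2.getLast?_eq.symm.trans hm)
  refine ⟨Equiv.ofBijective _ ⟨hM.forgetActions_injective, M.forgetActions_surjective⟩, rfl,
    fun p q => ⟨M.forgetActions.map_prop p q, ?_⟩,
    fun i q r => ⟨M.forgetActions.map_act i q r, ?_⟩⟩
  · rintro ⟨m, hm, h⟩
    obtain rfl := last_unique hm
    exact h
  · rintro ⟨m, n, hm, hact, r_eq⟩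
    obtain rfl := last_unique hm
    let q' : M.unravel.State := ⟨(q.1.1 ++ [(i, n)], n), M.isPath_concat.2 ⟨_, q.2, hact, rfl⟩⟩
    obtain rfl : r = q' := hM.forgetActions_injective <| Subtype.ext <| r_eq.trans <|
      show M.root :: q.1.1.map Prod.snd ++ [n] = M.root :: (q.1.1 ++ [(i, n)]).map Prod.snd by simp
    exact ⟨hact, rfl⟩

end DisjointActions

end LTS

theorem mainTheorem1_general {P : Type u} {I : Type v} (M : LTS.{u, v, w} P I)
    (N : LTS.{u, v, x} P I) (hM : M.LocallyFinite) (hN : N.LocallyFinite) (k : ℕ) :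
    (∀ T ∈ LTS.finiteTrees.{u, v, y} P I k, Finite (LTS.Hom T M) ∧ Finite (LTS.Hom T N)) ∧
    List.TFAE [
      ∀ T ∈ LTS.finiteTrees.{u, v, y} P I k, LTS.homCount T M = LTS.homCount T N,
      LTS.Isomorphic (M.unravel.truncate k) (N.unravel.truncate k),
      GML.EquivUpTo k M N] ∧
    (M.DisjointActions → N.DisjointActions →
      List.TFAE [
        ∀ T ∈ LTS.finiteTrees.{u, v, y} P I k, LTS.homCount T M = LTS.homCount T N,
        LTS.Isomorphic (M.stateUnravel.truncate k) (N.stateUnravel.truncate k),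
        GML.EquivUpTo k M N]) := by
  have equivalence : List.TFAE [
      ∀ T ∈ LTS.finiteTrees.{u, v, y} P I k, LTS.homCount T M = LTS.homCount T N,
      LTS.Isomorphic (M.unravel.truncate k) (N.unravel.truncate k),
      GML.EquivUpTo k M N] := by
    rw [GML.equivUpTo_iff_gradedBisim hM hN]
    tfae_have 1 → 3 := LTS.gradedBisim_of_homCount_eq hM hN
    tfae_have 3 → 2 := LTS.GradedBisim.isomorphic_unravel_truncate
    tfae_have 2 → 1 := fun iso T ⟨_, hT, hk⟩ => by
      rw [← hT.homCount_unravel_truncate hk M, iso.homCount_eq, hT.homCount_unravel_truncate hk N]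
    tfae_finish
  refine ⟨fun T ⟨_, hT, _⟩ => ⟨hT.finite_hom hM, hT.finite_hom hN⟩, equivalence, fun dM dN => ?_⟩
  rwa [← (dM.isomorphic_stateUnravel.truncate k).congr (dN.isomorphic_stateUnravel.truncate k)]

theorem mainTheorem1 {P : Type u} {I : Type v} [Finite P] [Finite I]
    (M : LTS.{u, v, w} P I) (N : LTS.{u, v, x} P I)
    (hM : M.ImageFinite) (hN : N.ImageFinite) (k : ℕ) :
    (∀ T ∈ LTS.finiteTrees.{u, v, y} P I k, Finite (LTS.Hom T M) ∧ Finite (LTS.Hom T N)) ∧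
    List.TFAE [
      ∀ T ∈ LTS.finiteTrees.{u, v, y} P I k, LTS.homCount T M = LTS.homCount T N,
      LTS.Isomorphic (M.unravel.truncate k) (N.unravel.truncate k),
      GML.EquivUpTo k M N] ∧
    (M.DisjointActions → N.DisjointActions →
      List.TFAE [
        ∀ T ∈ LTS.finiteTrees.{u, v, y} P I k, LTS.homCount T M = LTS.homCount T N,
        LTS.Isomorphic (M.stateUnravel.truncate k) (N.stateUnravel.truncate k),
        GML.EquivUpTo k M N]) :=
  mainTheorem1_general M N hM.locallyFinite hN.locallyFinite k
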